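/- Let $X_1,\dots,X_n$ be independent random variables taking values in $\{0,\tfrac12,1\}$, let $X=\sum_{i=1}^n X_i$ and $\mu=\mathbb E[X]$, and suppose that $\mathbb P(X\in\mathbb Z)>0$ and $\mathbb P(X\in\mathbb Z+\tfrac12)>0$. Write $\mu^{\mathrm{even}}=\mathbb E[X\mid X\in\mathbb Z]$ and $\mu^{\mathrm{odd}}=\mathbb E[X\mid X\in\mathbb Z+\tfrac12]$. A distribution is called Poisson binomial if it is the distribution of a sum of finitely many independent Bernoulli random variables, whose success probabilities in $[0,1]$ may differ. Then: 1. The conditional distribution of $X$ given $X\in\mathbb Z$ is Poisson binomial, and the conditional distribution of $X-\tfrac12$ given $X\in\mathbb Z+\tfrac12$ is Poisson binomial. 2. Hence both conditional distributions of $X$ are log-concave: with $f(k)=\mathbb P(X=k\mid X\in\mathbb Z)$, or with $f(k)=\mathbb P(X=k+\tfrac12\mid X\in\mathbb Z+\tfrac12)$, one has $f(k-1)f(k+1)\le f(k)^2$ for all $k\in\mathbb Z$, and $f$ has no internal zeros (if $i\le j\le k$ and $f(i),f(k)>0$, then $f(j)>0$). Each of the two conditional distributions of $X$ has either exactly one mode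 (point of maximal probability) or exactly two modes, at distance $1$ from each other. 3. $|\mu^{\mathrm{even}}-\mu|\le\tfrac12$ and $|\mu^{\mathrm{odd}}-\mu|\le\tfrac12$, and hence $|\mu^{\mathrm{even}}-\mu^{\mathrm{odd}}|\le 1$. 4. If $m_{\mathrm{even}}$ is any mode of $X$ given $X\in\mathbb Z$ and $m_{\mathrm{odd}}$ is any mode of $X$ given $X\in\mathbb Z+\tfrac12$, then $$|m_{\mathrm{even}}-\mu^{\mathrm{even}}|<1,\quad |m_{\mathrm{odd}}-\mu^{\mathrm{odd}}|<1,\quad |m_{\mathrm{even}}-\mu|<\tfrac32,\quad |m_{\mathrm{odd}}-\mu|<\tfrac32,$$ and hence $|m_{\mathrm{even}}-m_{\mathrm{odd}}|\le\tfrac52$. -/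

import Mathlib

open MeasureTheory ProbabilityTheory

/-- The set `ℤ`, viewed inside `ℝ`. -/
def integerSet : Set ℝ := {x | ∃ k : ℤ, x = (k : ℝ)}

/-- The set `ℤ + 1/2`, viewed inside `ℝ`. -/
def halfIntegerSet : Set ℝ := {x | ∃ k : ℤ, x = (k : ℝ) + 1 / 2}

/-- The distribution on `ℝ` of the sum of `m` independent Bernoulli trials, the `i`-th of which
takes the value `1` with probability `p i` and the value `0` with probability `1 - p i`. -/
noncomputable def poissonBinomial {m : ℕ} (p : Fin m → unitInterval) : Measure ℝ :=
  (Measure.pi fun i => bernoulliMeasure (1 : ℝ) 0 (p i)).map fun x => ∑ i, x i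

/-- A measure on `ℝ` is Poisson binomial if it is the distribution of the sum of finitely many
independent Bernoulli trials. -/
def IsPoissonBinomial (ν : Measure ℝ) : Prop :=
  ∃ (m : ℕ) (p : Fin m → unitInterval), ν = poissonBinomial p

/-- The conditional distribution of the real random variable `Y` given the event `Y ∈ A`. -/
noncomputable def condLaw {Ω : Type*} [MeasurableSpace Ω] (P : Measure Ω) (Y : Ω → ℝ)
    (A : Set ℝ) : Measure ℝ :=
  (cond P (Y ⁻¹' A)).map Y

/-- The conditional mean of the real random variable `Y` given the event `Y ∈ A`. -/
noncomputable def condMean {Ω : Type*} [MeasurableSpace Ω] (P : Measure Ω) (Y : Ω → ℝ)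
    (A : Set ℝ) : ℝ :=
  ∫ ω, Y ω ∂(cond P (Y ⁻¹' A))

/-- A sequence of nonnegative reals is log-concave if `f (k - 1) * f (k + 1) ≤ f k ^ 2` for
all `k` and it has no internal zeros. -/
def IsLogConcave (f : ℤ → ℝ) : Prop :=
  (∀ k, 0 ≤ f k) ∧ (∀ k, f (k - 1) * f (k + 1) ≤ f k ^ 2) ∧
    ∀ i j k, i ≤ j → j ≤ k → 0 < f i → 0 < f k → 0 < f j

/-- `m` is a mode of the discrete distribution `ν`: a point of maximal mass. -/
def IsMode (ν : Measure ℝ) (m : ℝ) : Prop :=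
  ∀ x : ℝ, ν {x} ≤ ν {m}

/-- `ν` has exactly one mode, or exactly two modes and these are at distance `1`. -/
def HasOneOrTwoAdjacentModes (ν : Measure ℝ) : Prop :=
  ∃ m : ℝ, {x | IsMode ν x} = {m} ∨ {x | IsMode ν x} = {m, m + 1}

/-!
Let `f = ∏ i, (a i + b i X + c i X ^ 2)` be the generating polynomial of twice the sum, and write
`f(X) = e(X ^ 2) + X * o(X ^ 2)`. Up to normalization, `e` and `o` generate the conditional laws on
the integers and on the half-integers.

*Poisson binomial laws.* For `re z > 0`, each factor satisfies `|q(-z)| < |q(z)|`, unless it is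
even or odd, and it does not vanish; this passes to `f` (`RightHalfPlaneDominant`). A nonreal zero
`z ^ 2` of `e` or `o`, with `re z > 0`, would give `f(-z) = ∓ f(z)`, which is excluded. So `e` and
`o` have only real zeros, which are nonpositive because the coefficients are nonnegative, and a
factor `X - r` with `r ≤ 0` is, up to a constant, the generating polynomial of a Bernoulli variable
with success probability `1 / (1 - r)` (`Polynomial.Splits.exists_eq_bernoulliProd`).

*Log-concavity and modes.* A strict form of log-concavity is preserved by convolution with Bernoulli
laws (`StrictlyLogConcave.convolve_bernoulli`), and it allows at most two maximizers, which are then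
adjacent.

*Means.* The distance of the conditional means from the mean is a multiple of
`f'(-1) + f'(1) f(-1)`, and `|f'(-1) + f'(1) f(-1)| ≤ 1 - |f(-1)|` is stable under products
(`ParityMeanBound.mul`).

*Mode and mean.* This is Darroch's theorem. For a Bernoulli product with coefficients `F k`, let
`G i k` be the coefficients of the product without the `i`-th factor. The derivative identity
`∑ i, p i * G i (k - 1) = k * F k` and its reflection give
`∑ i, (1 - p i) * (G i (k - 1) - F (k - 1)) = (∑ i, p i - (k - 1)) * F (k - 1)`. If
`F (k - 1) ≤ F k`, log-concavity of `G i` makes every summand nonnegative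
(`sub_one_lt_sum_of_le`).

Laws and polynomials are matched through characteristic functions (`map_sum_eq_atomicMeasure`).
-/

open Polynomial

/-! ### Dominance in the right half-plane -/

/-- A real polynomial without zeros in the open right half-plane that is there either strictly
dominated in modulus by its reflection through the origin, or even, or odd. Products of quadratics
with nonnegative coefficients have this property. -/
def RightHalfPlaneDominant (f : ℝ[X]) : Prop :=
  (∀ z : ℂ, 0 < z.re → aeval z f ≠ 0) ∧
    ((∀ z : ℂ, 0 < z.re → ‖aeval (-z) f‖ < ‖aeval z f‖) ∨
      (∀ z : ℂ, aeval (-z) f = aeval z f) ∨ ∀ z : ℂ, aeval (-z) f = -aeval z f)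

lemma RightHalfPlaneDominant.one : RightHalfPlaneDominant 1 := by
  simp [RightHalfPlaneDominant]

lemma RightHalfPlaneDominant.mul {f g : ℝ[X]} (hf : RightHalfPlaneDominant f)
    (hg : RightHalfPlaneDominant g) : RightHalfPlaneDominant (f * g) := by
  obtain ⟨hf0, hf⟩ := hf
  obtain ⟨hg0, hg⟩ := hg
  refine ⟨fun z hz => by simpa using ⟨hf0 z hz, hg0 z hz⟩, ?_⟩
  simp only [map_mul, norm_mul]
  have hfpos : ∀ z : ℂ, 0 < z.re → 0 < ‖aeval z f‖ := fun z hz => norm_pos_iff.2 (hf0 z hz)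
  have hgpos : ∀ z : ℂ, 0 < z.re → 0 < ‖aeval z g‖ := fun z hz => norm_pos_iff.2 (hg0 z hz)
  rcases hf with hf | hf | hf <;> rcases hg with hg | hg | hg
  · exact Or.inl fun z hz => mul_lt_mul'' (hf z hz) (hg z hz) (norm_nonneg _) (norm_nonneg _)
  · exact Or.inl fun z hz => by rw [hg]; exact mul_lt_mul_of_pos_right (hf z hz) (hgpos z hz)
  · exact Or.inl fun z hz => by
      rw [hg, norm_neg]; exact mul_lt_mul_of_pos_right (hf z hz) (hgpos z hz)
  · exact Or.inl fun z hz => by rw [hf]; exact mul_lt_mul_of_pos_left (hg z hz) (hfpos z hz)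
  · exact Or.inr (Or.inl fun z => by rw [hf, hg])
  · exact Or.inr (Or.inr fun z => by rw [hf, hg, mul_neg])
  · exact Or.inl fun z hz => by
      rw [hf, norm_neg]; exact mul_lt_mul_of_pos_left (hg z hz) (hfpos z hz)
  · exact Or.inr (Or.inr fun z => by rw [hf, hg, neg_mul])
  · exact Or.inr (Or.inl fun z => by rw [hf, hg, neg_mul_neg])

lemma RightHalfPlaneDominant.prod {ι : Type*} (s : Finset ι) (f : ι → ℝ[X])
    (hf : ∀ i ∈ s, RightHalfPlaneDominant (f i)) : RightHalfPlaneDominant (∏ i ∈ s, f i) :=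
  Finset.prod_induction f RightHalfPlaneDominant (fun _ _ => .mul) .one hf

/-- The polynomial `a + b X + c X ^ 2`. -/
noncomputable def quadratic (a b c : ℝ) : ℝ[X] := C a + C b * X + C c * X ^ 2

lemma aeval_quadratic (a b c : ℝ) (z : ℂ) :
    aeval z (quadratic a b c) = a + b * z + c * z ^ 2 := by
  simp [quadratic]

lemma RightHalfPlaneDominant.quadratic {a b c : ℝ} (ha : 0 ≤ a) (hb : 0 ≤ b) (hc : 0 ≤ c)
    (h : 0 < a + b + c) : RightHalfPlaneDominant (quadratic a b c) := by
  -- The gap between the squared moduli at `z` and `-z` is `4 * b * re z * (a + c * |z| ^ 2)`.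
  have gap : ∀ z : ℂ, Complex.normSq (a + b * z + c * z ^ 2) =
      Complex.normSq (a + b * (-z) + c * (-z) ^ 2) +
        4 * b * z.re * (a + c * (z.re ^ 2 + z.im ^ 2)) := by
    intro z
    simp [Complex.normSq_apply, pow_two]
    ring
  rcases hb.eq_or_lt with rfl | hb
  · refine ⟨fun z hz => ?_, Or.inr (Or.inl fun z => by simp [aeval_quadratic])⟩
    rw [aeval_quadratic]
    intro h0
    have h1 := congrArg Complex.re h0
    have h2 := congrArg Complex.im h0
    simp [pow_two] at h1 h2
    rcases hc.eq_or_lt with rfl | hc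
    · simp at h h1; linarith
    · have h3 : z.im = 0 := by
        have : z.re * z.im = 0 := by linarith [h2.resolve_left hc.ne']
        exact (mul_eq_zero.1 this).resolve_left hz.ne'
      rw [h3] at h1
      have : 0 < c * (z.re * z.re) := by positivity
      linarith
  · by_cases hac : a + c = 0
    · have ha0 : a = 0 := by linarith
      have hc0 : c = 0 := by linarith
      subst ha0 hc0
      refine ⟨fun z hz => ?_, Or.inr (Or.inr fun z => by simp [aeval_quadratic])⟩
      have : z ≠ 0 := by rintro rfl; simp at hz
      simpa [aeval_quadratic, this] using hb.ne'
    · have hpos : ∀ z : ℂ, 0 < z.re → 0 < 4 * b * z.re * (a + c * (z.re ^ 2 + z.im ^ 2)) := by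
        intro z hz
        have : 0 < a + c * (z.re ^ 2 + z.im ^ 2) := by
          rcases ha.eq_or_lt with rfl | ha
          · have : 0 < c := lt_of_le_of_ne hc (by simpa using Ne.symm hac)
            positivity
          · positivity
        positivity
      refine ⟨fun z hz => ?_, Or.inl fun z hz => ?_⟩
      · rw [aeval_quadratic, ← Complex.normSq_pos, gap]
        have := Complex.normSq_nonneg (a + b * (-z) + c * (-z) ^ 2)
        linarith [hpos z hz]
      · rw [aeval_quadratic, aeval_quadratic]
        refine lt_of_pow_lt_pow_left₀ 2 (norm_nonneg _) ?_
        rw [← Complex.normSq_eq_norm_sq, ← Complex.normSq_eq_norm_sq, gap z]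
        linarith [hpos z hz]

/-! ### Even and odd parts -/

/-- The polynomial `e` of the decomposition `f(X) = e(X ^ 2) + X * o(X ^ 2)`. -/
noncomputable def evenPart (f : ℝ[X]) : ℝ[X] := contract 2 f

/-- The polynomial `o` of the decomposition `f(X) = e(X ^ 2) + X * o(X ^ 2)`. -/
noncomputable def oddPart (f : ℝ[X]) : ℝ[X] := contract 2 f.divX

lemma coeff_evenPart (f : ℝ[X]) (k : ℕ) : (evenPart f).coeff k = f.coeff (2 * k) := by
  rw [evenPart, coeff_contract two_ne_zero, mul_comm]

lemma coeff_oddPart (f : ℝ[X]) (k : ℕ) : (oddPart f).coeff k = f.coeff (2 * k + 1) := by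
  rw [oddPart, coeff_contract two_ne_zero, coeff_divX, mul_comm]

lemma expand_evenPart_add_expand_oddPart (f : ℝ[X]) :
    expand ℝ 2 (evenPart f) + X * expand ℝ 2 (oddPart f) = f := by
  ext k
  rcases Nat.even_or_odd' k with ⟨j, rfl | rfl⟩
  · rw [coeff_add, coeff_expand two_pos, if_pos (dvd_mul_right 2 j),
      Nat.mul_div_cancel_left _ two_pos, coeff_evenPart]
    cases j with
    | zero => simp
    | succ j =>
      rw [show 2 * (j + 1) = (2 * j + 1) + 1 by ring, coeff_X_mul, coeff_expand two_pos,
        if_neg (by omega), add_zero]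
  · rw [coeff_add, coeff_expand two_pos, if_neg (by omega), coeff_X_mul, coeff_expand two_pos,
      if_pos (dvd_mul_right 2 j), Nat.mul_div_cancel_left _ two_pos, coeff_oddPart, zero_add]

lemma aeval_eq_evenPart_add_oddPart (f : ℝ[X]) (z : ℂ) :
    aeval z f = aeval (z ^ 2) (evenPart f) + z * aeval (z ^ 2) (oddPart f) := by
  conv_lhs => rw [← expand_evenPart_add_expand_oddPart f]
  simp [expand_aeval]

lemma Complex.exists_re_pos_sq_eq {w : ℂ} (hw : w.im ≠ 0) : ∃ z : ℂ, 0 < z.re ∧ z ^ 2 = w := by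
  obtain ⟨z, hz⟩ := IsAlgClosed.exists_pow_nat_eq w two_pos
  rcases lt_trichotomy z.re 0 with h | h | h
  · exact ⟨-z, by simpa using h, by rw [neg_sq, hz]⟩
  · refine absurd ?_ hw
    simp [← hz, pow_two, h]
  · exact ⟨z, h, hz⟩

/-- A nonreal zero `z ^ 2` of the even part, with `z` in the right half-plane, gives `f(-z) = -f(z)`.
This contradicts strict dominance, and also evenness as `f(z) ≠ 0`; if `f` is odd, then its even
part vanishes. -/
lemma RightHalfPlaneDominant.real_root_evenPart {f : ℝ[X]} (hf : RightHalfPlaneDominant f)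
    (h1 : (evenPart f).eval 1 ≠ 0) {w : ℂ} (hw : aeval w (evenPart f) = 0) : w.im = 0 := by
  by_contra him
  obtain ⟨z, hz, rfl⟩ := Complex.exists_re_pos_sq_eq him
  have e1 := aeval_eq_evenPart_add_oddPart f z
  have e2 := aeval_eq_evenPart_add_oddPart f (-z)
  rw [neg_sq, hw] at e2
  rw [hw] at e1
  have hodd : aeval (-z) f = -aeval z f := by rw [e1, e2]; ring
  rcases hf.2 with h | h | h
  · exact absurd (h z hz) (by rw [hodd, norm_neg]; exact lt_irrefl _)
  · exact hf.1 z hz (self_eq_neg.1 ((h z).symm.trans hodd))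
  · refine h1 ?_
    have e3 := aeval_eq_evenPart_add_oddPart f 1
    have e4 := aeval_eq_evenPart_add_oddPart f (-1)
    rw [h, e3] at e4
    have e5 : aeval (1 : ℂ) (evenPart f) = 0 := by
      norm_num at e4
      linear_combination (-1 / 2 : ℂ) * e4
    have := aeval_algebraMap_apply ℂ (1 : ℝ) (evenPart f)
    rw [map_one, e5] at this
    simpa using this.symm

lemma RightHalfPlaneDominant.real_root_oddPart {f : ℝ[X]} (hf : RightHalfPlaneDominant f)
    (h1 : (oddPart f).eval 1 ≠ 0) {w : ℂ} (hw : aeval w (oddPart f) = 0) : w.im = 0 := by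
  by_contra him
  obtain ⟨z, hz, rfl⟩ := Complex.exists_re_pos_sq_eq him
  have e1 := aeval_eq_evenPart_add_oddPart f z
  have e2 := aeval_eq_evenPart_add_oddPart f (-z)
  rw [neg_sq, hw] at e2
  rw [hw] at e1
  have heven : aeval (-z) f = aeval z f := by rw [e1, e2]; ring
  rcases hf.2 with h | h | h
  · exact absurd (h z hz) (by rw [heven]; exact lt_irrefl _)
  · refine h1 ?_
    have e3 := aeval_eq_evenPart_add_oddPart f 1
    have e4 := aeval_eq_evenPart_add_oddPart f (-1)
    rw [h, e3] at e4
    have e5 : aeval (1 : ℂ) (oddPart f) = 0 := by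
      norm_num at e4
      linear_combination (1 / 2 : ℂ) * e4
    have := aeval_algebraMap_apply ℂ (1 : ℝ) (oddPart f)
    rw [map_one, e5] at this
    simpa using this.symm
  · exact hf.1 z hz (self_eq_neg.1 (heven.symm.trans (h z)))

/-! ### Real-rooted polynomials as Bernoulli products -/

lemma splits_of_real_roots {g : ℝ[X]} (h : ∀ w : ℂ, aeval w g = 0 → w.im = 0) : g.Splits := by
  refine Splits.of_splits_map (algebraMap ℝ ℂ) (IsAlgClosed.splits _) fun w hw => ?_
  refine ⟨w.re, ?_⟩
  have := h w (by simpa [eval_map_algebraMap] using (mem_roots'.1 hw).2)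
  apply Complex.ext <;> simp [this]

/-- The generating polynomial `∏ i ∈ s, (1 - p i + p i * X)` of a sum of independent Bernoulli
variables. -/
noncomputable def bernoulliProd {ι : Type*} (s : Finset ι) (p : ι → ℝ) : ℝ[X] :=
  ∏ i ∈ s, (C (1 - p i) + C (p i) * X)

lemma exists_prod_X_sub_C_eq (s : Multiset ℝ) (hs : ∀ r ∈ s, r ≤ 0) :
    ∃ (c : ℝ) (m : ℕ) (p : Fin m → unitInterval),
      (s.map fun r => X - C r).prod = C c * bernoulliProd Finset.univ fun i => (p i : ℝ) := by
  induction s using Multiset.induction with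
  | empty => exact ⟨1, 0, Fin.elim0, by simp [bernoulliProd]⟩
  | cons r s ih =>
    obtain ⟨c, m, p, h⟩ := ih fun r hr => hs r (Multiset.mem_cons_of_mem hr)
    have hr : 0 < 1 - r := by linarith [hs r (Multiset.mem_cons_self r s)]
    -- A root `r ≤ 0` corresponds to the success probability `1 / (1 - r)`.
    refine ⟨c * (1 - r), m + 1, Fin.cons ⟨(1 - r)⁻¹, by positivity,
      inv_le_one_of_one_le₀ (by linarith [hs r (Multiset.mem_cons_self r s)])⟩ p, ?_⟩
    have key : X - C r = C (1 - r) * (C (1 - (1 - r)⁻¹) + C (1 - r)⁻¹ * X) := by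
      rw [mul_add, ← mul_assoc, ← C_mul, ← C_mul, mul_inv_cancel₀ hr.ne', mul_sub,
        mul_inv_cancel₀ hr.ne']
      simp
      ring
    rw [Multiset.map_cons, Multiset.prod_cons, h, key]
    simp only [bernoulliProd, Fin.prod_univ_succ, Fin.cons_zero, Fin.cons_succ, C_mul]
    ring

/-- A polynomial with nonnegative coefficients summing to one and only real zeros is the generating
polynomial of a sum of independent Bernoulli variables. -/
lemma Polynomial.Splits.exists_eq_bernoulliProd {g : ℝ[X]} (hg : g.Splits)
    (h0 : ∀ k, 0 ≤ g.coeff k) (h1 : g.eval 1 = 1) :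
    ∃ (m : ℕ) (p : Fin m → unitInterval), g = bernoulliProd Finset.univ fun i => (p i : ℝ) := by
  have hroots : ∀ r ∈ g.roots, r ≤ 0 := by
    intro r hr
    by_contra! hpos
    have hr0 : g.eval r = 0 := (mem_roots'.1 hr).2
    rw [eval_eq_sum_range] at hr0
    have hz := (Finset.sum_eq_zero_iff_of_nonneg
      (fun k _ => mul_nonneg (h0 k) (pow_nonneg hpos.le k))).1 hr0
    rw [eval_eq_sum_range, Finset.sum_eq_zero] at h1
    · exact zero_ne_one h1
    · intro k hk
      rw [(mul_eq_zero.1 (hz k hk)).resolve_right (by positivity), zero_mul]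
  obtain ⟨c, m, p, h⟩ := exists_prod_X_sub_C_eq g.roots hroots
  refine ⟨m, p, ?_⟩
  have hg' := hg.eq_prod_roots
  rw [h, ← mul_assoc, ← C_mul] at hg'
  have hc := congrArg (eval 1) hg'
  rw [h1] at hc
  simp [bernoulliProd, eval_prod] at hc
  rw [hg', ← hc]
  simp

/-! ### Strictly log-concave sequences -/

/-- The coefficients of a polynomial as a sequence indexed by `ℤ`, zero at negative indices. -/
noncomputable def intCoeff (f : ℝ[X]) (k : ℤ) : ℝ := if 0 ≤ k then f.coeff k.toNat else 0

@[simp]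
lemma intCoeff_natCast (f : ℝ[X]) (k : ℕ) : intCoeff f k = f.coeff k := by simp [intCoeff]

lemma intCoeff_of_neg (f : ℝ[X]) {k : ℤ} (hk : k < 0) : intCoeff f k = 0 := by
  simp [intCoeff, hk]

lemma intCoeff_linear_mul (a b : ℝ) (f : ℝ[X]) (k : ℤ) :
    intCoeff ((C a + C b * X) * f) k = a * intCoeff f k + b * intCoeff f (k - 1) := by
  rcases lt_or_ge k 0 with hk | hk
  · simp [intCoeff_of_neg _ hk, intCoeff_of_neg f (show k - 1 < 0 by omega)]
  · lift k to ℕ using hk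
    cases k with
    | zero =>
      have := intCoeff_of_neg f (show ((0 : ℕ) : ℤ) - 1 < 0 by simp)
      rw [this, intCoeff_natCast, intCoeff_natCast]
      simp [mul_coeff_zero]
    | succ k =>
      rw [show ((k + 1 : ℕ) : ℤ) - 1 = (k : ℕ) by simp]
      simp only [intCoeff_natCast, add_mul, coeff_add, coeff_C_mul, mul_assoc, coeff_X_mul]

lemma intCoeff_derivative (f : ℝ[X]) (k : ℤ) :
    intCoeff (derivative f) (k - 1) = k * intCoeff f k := by
  rcases lt_or_ge k 1 with hk | hk
  · rw [intCoeff_of_neg _ (show k - 1 < 0 by omega)]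
    rcases (show k ≤ 0 by omega).lt_or_eq with h | rfl
    · rw [intCoeff_of_neg _ h, mul_zero]
    · simp
  · obtain ⟨j, rfl⟩ : ∃ j : ℕ, k = (j + 1 : ℕ) := ⟨(k - 1).toNat, by omega⟩
    rw [show ((j + 1 : ℕ) : ℤ) - 1 = (j : ℕ) by simp, intCoeff_natCast, intCoeff_natCast,
      coeff_derivative]
    push_cast
    ring

lemma intCoeff_sum {ι : Type*} (s : Finset ι) (f : ι → ℝ[X]) (k : ℤ) :
    intCoeff (∑ i ∈ s, f i) k = ∑ i ∈ s, intCoeff (f i) k := by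
  unfold intCoeff
  split_ifs <;> simp

lemma intCoeff_C_mul (a : ℝ) (f : ℝ[X]) (k : ℤ) : intCoeff (C a * f) k = a * intCoeff f k := by
  unfold intCoeff
  split_ifs <;> simp

/-- A nonnegative sequence that is log-concave in the form stable under convolution (a total
positivity of order two, which excludes internal zeros), with strict inequality for adjacent terms
on the support. -/
structure StrictlyLogConcave (f : ℤ → ℝ) : Prop where
  nonneg : ∀ k, 0 ≤ f k
  mul_le_mul : ∀ i j, i ≤ j → f (i - 1) * f (j + 1) ≤ f i * f j
  mul_lt_sq : ∀ k, 0 < f k → f (k - 1) * f (k + 1) < f k ^ 2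

namespace StrictlyLogConcave

variable {f : ℤ → ℝ}

/-- Convolution with a Bernoulli distribution preserves strict log-concavity. Expanding the products,
the mixed terms with factor `(1 - p) * p` are controlled by `cross`. -/
lemma convolve_bernoulli (hf : StrictlyLogConcave f) {p : ℝ} (h0 : 0 ≤ p) (h1 : p ≤ 1) :
    StrictlyLogConcave fun k => (1 - p) * f k + p * f (k - 1) := by
  have hq : 0 ≤ 1 - p := by linarith
  have cross : ∀ i j, i ≤ j → f (i - 1 - 1) * f (j + 1) ≤ f i * f (j - 1) := by
    intro i j hij
    have h2 := hf.mul_le_mul (i - 1) j (by omega)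
    rcases hij.eq_or_lt with rfl | hlt
    · linarith [mul_comm (f i) (f (i - 1))]
    · have h3 := hf.mul_le_mul i (j - 1) (by omega)
      rw [sub_add_cancel] at h3
      exact h2.trans h3
  refine ⟨fun k => ?_, fun i j hij => ?_, fun k hk => ?_⟩
  · exact add_nonneg (mul_nonneg hq (hf.nonneg _)) (mul_nonneg h0 (hf.nonneg _))
  · have a1 := mul_le_mul_of_nonneg_left (hf.mul_le_mul i j hij) (mul_nonneg hq hq)
    have a2 := hf.mul_le_mul (i - 1) (j - 1) (by omega)
    have a3 := mul_le_mul_of_nonneg_left (cross i j hij) (mul_nonneg hq h0)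
    rw [sub_add_cancel] at a2
    have a4 := mul_le_mul_of_nonneg_left a2 (mul_nonneg h0 h0)
    simp only [add_sub_cancel_right]
    linarith
  · have a1 := hf.mul_le_mul k k le_rfl
    have a2 := hf.mul_le_mul (k - 1) (k - 1) le_rfl
    have a3 := mul_le_mul_of_nonneg_left (cross k k le_rfl) (mul_nonneg hq h0)
    simp only [sub_add_cancel] at a2
    simp only [add_sub_cancel_right]
    have b1 := mul_le_mul_of_nonneg_left a1 (mul_nonneg hq hq)
    have b2 := mul_le_mul_of_nonneg_left a2 (mul_nonneg h0 h0)
    rcases (mul_nonneg hq (hf.nonneg k)).eq_or_lt with hz | hpos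
    · have hpos : 0 < p * f (k - 1) := by linarith
      have hp : 0 < p := pos_of_mul_pos_left hpos (hf.nonneg _)
      have := hf.mul_lt_sq (k - 1) (pos_of_mul_pos_right hpos h0)
      rw [sub_add_cancel] at this
      have := mul_lt_mul_of_pos_left this (mul_pos hp hp)
      linarith
    · have hp : 0 < 1 - p := pos_of_mul_pos_left hpos (hf.nonneg _)
      have := mul_lt_mul_of_pos_left (hf.mul_lt_sq k (pos_of_mul_pos_right hpos hq))
        (mul_pos hp hp)
      linarith

lemma pos_of_le_of_le (hf : StrictlyLogConcave f) {i j k : ℤ} (hij : i ≤ j) (hjk : j ≤ k)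
    (hi : 0 < f i) (hk : 0 < f k) : 0 < f j := by
  induction j, hij using Int.leInduction with
  | base => exact hi
  | succ j hij ih =>
    rcases hjk.eq_or_lt with rfl | hlt
    · exact hk
    · have h := hf.mul_le_mul (j + 1) (k - 1) (by omega)
      rw [add_sub_cancel_right, sub_add_cancel] at h
      exact pos_of_mul_pos_left ((mul_pos (ih (by omega)) hk).trans_le h) (hf.nonneg _)

lemma isLogConcave (hf : StrictlyLogConcave f) : IsLogConcave f :=
  ⟨hf.nonneg, fun k => (hf.mul_le_mul k k le_rfl).trans_eq (sq _).symm,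
    fun _ _ _ hij hjk hi hk => hf.pos_of_le_of_le hij hjk hi hk⟩

/-- Two maximizers of a strictly log-concave sequence are equal or adjacent. -/
lemma maximizers_adjacent (hf : StrictlyLogConcave f) {k : ℤ} (hk : ∀ j, f j ≤ f k)
    (hpos : 0 < f k) (d : ℕ) : ¬ ∀ j, f j ≤ f (k + 2 + d) := by
  induction d with
  | zero =>
    intro hl
    have h1 := hf.pos_of_le_of_le (j := k + 1) (by omega) (by omega) hpos (hpos.trans_le (hl k))
    have h2 := hf.mul_lt_sq (k + 1) h1
    rw [add_sub_cancel_right, show k + 1 + 1 = k + 2 + (0 : ℕ) by push_cast; ring] at h2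
    have h3 := hl k
    have h4 := hk (k + 1)
    nlinarith
  | succ d ih =>
    intro hl
    refine ih fun j => (hk j).trans ?_
    -- The product of the end values is at most the product of the two values next to them.
    have h2 := hf.mul_le_mul (k + 1) (k + 2 + d) (by omega)
    rw [add_sub_cancel_right, show k + 2 + (d : ℤ) + 1 = k + 2 + (d + 1 : ℕ) by push_cast; ring]
      at h2
    have h3 := hl k
    have h4 := hk (k + 1)
    have h5 := hf.nonneg (k + 2 + d)
    have h6 : f k * f k ≤ f k * f (k + 2 + d) :=
      (mul_le_mul_of_nonneg_left h3 hpos.le).trans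
        (h2.trans (mul_le_mul_of_nonneg_right h4 h5))
    exact le_of_mul_le_mul_left h6 hpos

lemma exists_maximizers_eq (hf : StrictlyLogConcave f) {k : ℤ} (hk : ∀ j, f j ≤ f k)
    (hpos : 0 < f k) :
    ∃ m : ℤ, {l | ∀ j, f j ≤ f l} = {m} ∨ {l | ∀ j, f j ≤ f l} = {m, m + 1} := by
  have adj : ∀ a b : ℤ, (∀ j, f j ≤ f a) → (∀ j, f j ≤ f b) → b ≤ a + 1 := by
    intro a b ha hb
    by_contra! h
    refine hf.maximizers_adjacent ha (hpos.trans_le (ha k)) (b - a - 2).toNat ?_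
    rwa [show a + 2 + ((b - a - 2).toNat : ℤ) = b by omega]
  by_cases h1 : ∀ j, f j ≤ f (k + 1)
  · refine ⟨k, Or.inr (Set.ext fun l => ⟨fun hl => ?_, ?_⟩)⟩
    · have := adj k l hk hl
      have := adj l (k + 1) hl h1
      simp only [Set.mem_insert_iff, Set.mem_singleton_iff]
      omega
    · rintro (rfl | rfl)
      exacts [hk, h1]
  · by_cases h2 : ∀ j, f j ≤ f (k - 1)
    · refine ⟨k - 1, Or.inr (Set.ext fun l => ⟨fun hl => ?_, ?_⟩)⟩
      · have := adj (k - 1) l h2 hl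
        have := adj l k hl hk
        simp only [Set.mem_insert_iff, Set.mem_singleton_iff]
        omega
      · rintro (rfl | rfl)
        exacts [h2, by rwa [sub_add_cancel]]
    · refine ⟨k, Or.inl (Set.ext fun l => ⟨fun hl => ?_, ?_⟩)⟩
      · have := adj k l hk hl
        have := adj l k hl hk
        have : l ≠ k + 1 := by rintro rfl; exact h1 hl
        have : l ≠ k - 1 := by rintro rfl; exact h2 hl
        simp only [Set.mem_singleton_iff]
        omega
      · rintro rfl
        exact hk

end StrictlyLogConcave

/-! ### Coefficients of Bernoulli products and Darroch's inequality -/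

section BernoulliProd

variable {ι : Type*} {s : Finset ι} {p : ι → ℝ}

lemma strictlyLogConcave_intCoeff_one : StrictlyLogConcave (intCoeff 1) := by
  have h0 : intCoeff 1 0 = 1 := by simp [intCoeff]
  have h : ∀ k, k ≠ 0 → intCoeff 1 k = 0 := by
    intro k hk
    rcases lt_or_ge k 0 with h | h
    · exact intCoeff_of_neg _ h
    · lift k to ℕ using h
      rw [intCoeff_natCast, coeff_one, if_neg (by simpa using hk)]
  have hnn : ∀ k, 0 ≤ intCoeff 1 k := by
    intro k
    rcases eq_or_ne k 0 with rfl | hk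
    · simp [h0]
    · simp [h k hk]
  have hzero : ∀ i j : ℤ, i ≤ j → intCoeff 1 (i - 1) * intCoeff 1 (j + 1) = 0 := by
    intro i j hij
    rcases eq_or_ne (i - 1) 0 with hi | hi
    · rw [h (j + 1) (by omega), mul_zero]
    · rw [h _ hi, zero_mul]
  exact ⟨hnn, fun i j hij => (hzero i j hij).trans_le (mul_nonneg (hnn i) (hnn j)),
    fun k hk => (hzero k k le_rfl).trans_lt (by positivity)⟩

lemma strictlyLogConcave_intCoeff_bernoulliProd (h0 : ∀ i, 0 ≤ p i) (h1 : ∀ i, p i ≤ 1)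
    (s : Finset ι) : StrictlyLogConcave (intCoeff (bernoulliProd s p)) := by
  classical
  induction s using Finset.induction with
  | empty => simpa [bernoulliProd] using strictlyLogConcave_intCoeff_one
  | insert i s hi ih =>
    rw [bernoulliProd, Finset.prod_insert hi, ← bernoulliProd]
    have := ih.convolve_bernoulli (h0 i) (h1 i)
    simpa only [← intCoeff_linear_mul] using this

lemma eval_one_bernoulliProd : (bernoulliProd s p).eval 1 = 1 := by
  simp [bernoulliProd, eval_prod]

lemma derivative_bernoulliProd [DecidableEq ι] :
    derivative (bernoulliProd s p) = ∑ i ∈ s, C (p i) * bernoulliProd (s.erase i) p := by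
  rw [bernoulliProd, derivative_prod_finset]
  exact Finset.sum_congr rfl fun i _ => by rw [mul_comm]; simp [bernoulliProd]

lemma eval_one_derivative_bernoulliProd :
    (derivative (bernoulliProd s p)).eval 1 = ∑ i ∈ s, p i := by
  classical
  simp [derivative_bernoulliProd, eval_finsetSum, eval_one_bernoulliProd]

lemma intCoeff_bernoulliProd_eq [DecidableEq ι] {i : ι} (hi : i ∈ s) (k : ℤ) :
    intCoeff (bernoulliProd s p) k = (1 - p i) * intCoeff (bernoulliProd (s.erase i) p) k +
      p i * intCoeff (bernoulliProd (s.erase i) p) (k - 1) := by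
  rw [← intCoeff_linear_mul, bernoulliProd, bernoulliProd, 
    Finset.mul_prod_erase s (fun i => C (1 - p i) + C (p i) * X) hi]

/-- The identity `g' = ∑ i, p i * g / (1 - p i + p i * X)`, read off at one coefficient. -/
lemma sum_mul_intCoeff_erase [DecidableEq ι] (k : ℤ) :
    ∑ i ∈ s, p i * intCoeff (bernoulliProd (s.erase i) p) (k - 1) =
      k * intCoeff (bernoulliProd s p) k := by
  rw [← intCoeff_derivative, derivative_bernoulliProd, intCoeff_sum]
  simp only [intCoeff_C_mul]

lemma sum_one_sub_mul_intCoeff_erase [DecidableEq ι] (k : ℤ) :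
    ∑ i ∈ s, (1 - p i) * intCoeff (bernoulliProd (s.erase i) p) k =
      (s.card - k) * intCoeff (bernoulliProd s p) k := by
  rw [sub_mul, ← sum_mul_intCoeff_erase, ← nsmul_eq_mul, ← Finset.sum_const,
    ← Finset.sum_sub_distrib]
  exact Finset.sum_congr rfl fun i hi => by rw [intCoeff_bernoulliProd_eq hi]; ring

/-- The inequality behind Darroch's theorem. With `F` and `F'` the masses at `m` and `m - 1` of a
sum of independent Bernoulli variables, and `y i`, `x i`, `z i` the masses at `m`, `m - 1`, `m - 2`
of the sum without its `i`-th term, the hypotheses are the one-term recurrences, log-concavity and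
the two derivative identities. Since `∑ i, q i * (x i - F') = (∑ i, p i - (m - 1)) * F'`, it is
enough that `F' ≤ x i`, which holds because `F' ≤ F` are averages of `x i, z i` and of `y i, x i`.
The hypotheses are symmetric under exchanging `p` with `q`, `y` with `z` and `F` with `F'`. -/
lemma sub_one_lt_sum_of_le {q x y z : ι → ℝ} {F F' m : ℝ}
    (hp : ∀ i ∈ s, 0 ≤ p i) (hq : ∀ i ∈ s, 0 ≤ q i) (hpq : ∀ i ∈ s, q i + p i = 1)
    (hx : ∀ i ∈ s, 0 ≤ x i) (hz : ∀ i ∈ s, 0 ≤ z i)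
    (hle : ∀ i ∈ s, y i * z i ≤ x i ^ 2) (hlt : ∀ i ∈ s, 0 < x i → y i * z i < x i ^ 2)
    (hF : ∀ i ∈ s, F = q i * y i + p i * x i) (hF' : ∀ i ∈ s, F' = q i * x i + p i * z i)
    (hpx : ∑ i ∈ s, p i * x i = m * F)
    (hqx : ∑ i ∈ s, q i * x i = (s.card - m + 1) * F')
    (hF0 : 0 ≤ F') (hFF : F' ≤ F) (hpos : 0 < F) : m - 1 < ∑ i ∈ s, p i := by
  have strict : ∀ i ∈ s, 0 < x i → x i ≤ z i → y i < x i := by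
    intro i hi h1 h2
    have := hlt i hi h1
    nlinarith [hz i hi]
  have weak : ∀ i ∈ s, x i < z i → y i ≤ x i := by
    intro i hi h
    rcases (hx i hi).eq_or_lt with h0 | h0
    · have h1 := hle i hi
      rw [← h0] at h h1 ⊢
      exact le_of_mul_le_mul_right (by linarith) h
    · exact (strict i hi h0 h.le).le
  have e1 : ∑ i ∈ s, p i * (x i - F) = (m - ∑ i ∈ s, p i) * F := by
    simp only [mul_sub, Finset.sum_sub_distrib, hpx, ← Finset.sum_mul, sub_mul]
  have e2 : ∑ i ∈ s, q i * (x i - F') = (∑ i ∈ s, p i - (m - 1)) * F' := by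
    have : ∑ i ∈ s, q i = s.card - ∑ i ∈ s, p i := by
      rw [eq_sub_iff_add_eq, ← Finset.sum_add_distrib, Finset.sum_congr rfl hpq]
      simp
    simp only [mul_sub, Finset.sum_sub_distrib, hqx, ← Finset.sum_mul, this]
    ring
  rcases hF0.eq_or_lt with h0 | h0
  · have : ∑ i ∈ s, p i * (x i - F) ≤ 0 := by
      refine Finset.sum_nonpos fun i hi => ?_
      have h1 := hF' i hi
      have h2 := mul_nonneg (hq i hi) (hx i hi)
      have h3 := mul_nonneg (hp i hi) (hz i hi)
      rcases mul_eq_zero.1 (show q i * x i = 0 by linarith) with h | h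
      · have h4 := hF i hi
        have h5 := hpq i hi
        rw [h, zero_add] at h5
        rw [h, h5] at h4
        rw [h4]
        simp
      · rw [h]
        nlinarith [hp i hi]
    rw [e1] at this
    have := nonpos_of_mul_nonpos_left this hpos
    linarith
  · have key : ∀ i ∈ s, F' ≤ x i := by
      intro i hi
      by_contra! hlt'
      have h1 := hF' i hi
      have h2 := hpq i hi
      have h3 : x i < z i := by nlinarith [hp i hi, hq i hi]
      have h4 := weak i hi h3
      have h5 := hF i hi
      nlinarith [hp i hi, hq i hi]
    by_contra! hcon
    have h1 : ∑ i ∈ s, q i * (x i - F') ≤ 0 := by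
      rw [e2]
      exact mul_nonpos_of_nonpos_of_nonneg (by linarith) h0.le
    have hnn : ∀ i ∈ s, 0 ≤ q i * (x i - F') := fun i hi =>
      mul_nonneg (hq i hi) (by linarith [key i hi])
    have h2 := (Finset.sum_eq_zero_iff_of_nonneg hnn).1 (le_antisymm h1 (Finset.sum_nonneg hnn))
    -- In the equality case every `p i` is `0` or `1`, and then `∑ i, p i = m`.
    have h3 : ∑ i ∈ s, p i * (x i - F) = 0 := by
      refine Finset.sum_eq_zero fun i hi => ?_
      have h4 := hF i hi
      have h5 := hpq i hi
      have h6 := hF' i hi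
      rcases mul_eq_zero.1 (h2 i hi) with h | h
      · rw [h, zero_add] at h5
        rw [h, h5] at h4
        rw [h4]
        simp
      · rcases (hp i hi).eq_or_lt with hp0 | hp0
        · rw [← hp0, zero_mul]
        · have hxF : x i = F' := by linarith
          have hzx : z i = x i := by
            have : p i * (z i - x i) = 0 := by
              linear_combination -hxF - h6 - x i * h5
            linarith [(mul_eq_zero.1 this).resolve_left hp0.ne']
          have h7 := strict i hi (by linarith) hzx.ge
          have hq0 : q i = 0 := by
            by_contra hne
            have : 0 < q i := lt_of_le_of_ne (hq i hi) (Ne.symm hne)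
            nlinarith
          rw [hq0, zero_add] at h5
          rw [hq0, h5] at h4
          rw [h4]
          simp
    rw [e1] at h3
    have := (mul_eq_zero.1 h3).resolve_right hpos.ne'
    linarith

lemma sub_one_lt_sum_of_intCoeff_le (h0 : ∀ i, 0 ≤ p i) (h1 : ∀ i, p i ≤ 1) {k : ℤ}
    (hk : intCoeff (bernoulliProd s p) (k - 1) ≤ intCoeff (bernoulliProd s p) k)
    (hpos : 0 < intCoeff (bernoulliProd s p) k) : (k : ℝ) - 1 < ∑ i ∈ s, p i := by
  classical
  have lc := fun i => strictlyLogConcave_intCoeff_bernoulliProd h0 h1 (s.erase i)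
  have hz : ∀ i, intCoeff (bernoulliProd (s.erase i) p) (k - 1 - 1) *
      intCoeff (bernoulliProd (s.erase i) p) k ≤
        intCoeff (bernoulliProd (s.erase i) p) (k - 1) ^ 2 := fun i => by
    simpa [sq] using (lc i).mul_le_mul (k - 1) (k - 1) le_rfl
  have hz' : ∀ i, 0 < intCoeff (bernoulliProd (s.erase i) p) (k - 1) →
      intCoeff (bernoulliProd (s.erase i) p) (k - 1 - 1) *
      intCoeff (bernoulliProd (s.erase i) p) k <
        intCoeff (bernoulliProd (s.erase i) p) (k - 1) ^ 2 := fun i h => by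
    simpa using (lc i).mul_lt_sq (k - 1) h
  refine sub_one_lt_sum_of_le (q := fun i => 1 - p i) (fun i _ => h0 i)
    (fun i _ => by linarith [h1 i]) (fun i _ => by ring)
    (fun i _ => (lc i).nonneg (k - 1)) (fun i _ => (lc i).nonneg (k - 1 - 1))
    (fun i _ => by rw [mul_comm]; exact hz i)
    (fun i _ h => by rw [mul_comm]; exact hz' i h)
    (fun i hi => intCoeff_bernoulliProd_eq hi k) (fun i hi => intCoeff_bernoulliProd_eq hi (k - 1))
    (sum_mul_intCoeff_erase k) ?_
    ((strictlyLogConcave_intCoeff_bernoulliProd h0 h1 s).nonneg _) hk hpos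
  rw [sum_one_sub_mul_intCoeff_erase]
  push_cast
  ring

lemma sum_lt_add_one_of_intCoeff_le (h0 : ∀ i, 0 ≤ p i) (h1 : ∀ i, p i ≤ 1) {k : ℤ}
    (hk : intCoeff (bernoulliProd s p) (k + 1) ≤ intCoeff (bernoulliProd s p) k)
    (hpos : 0 < intCoeff (bernoulliProd s p) k) : ∑ i ∈ s, p i < k + 1 := by
  classical
  have lc := fun i => strictlyLogConcave_intCoeff_bernoulliProd h0 h1 (s.erase i)
  have hz : ∀ i, intCoeff (bernoulliProd (s.erase i) p) (k - 1) *
      intCoeff (bernoulliProd (s.erase i) p) (k + 1) ≤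
        intCoeff (bernoulliProd (s.erase i) p) k ^ 2 := fun i => by
    simpa [sq] using (lc i).mul_le_mul k k le_rfl
  have hrec : ∀ i ∈ s, intCoeff (bernoulliProd s p) (k + 1) =
      p i * intCoeff (bernoulliProd (s.erase i) p) k +
        (1 - p i) * intCoeff (bernoulliProd (s.erase i) p) (k + 1) := fun i hi => by
    rw [intCoeff_bernoulliProd_eq hi, add_sub_cancel_right, add_comm]
  have hsum := sum_mul_intCoeff_erase (s := s) (p := p) (k + 1)
  rw [add_sub_cancel_right] at hsum
  have := sub_one_lt_sum_of_le (s := s) (p := fun i => 1 - p i) (q := p) (m := s.card - k)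
    (F := intCoeff (bernoulliProd s p) k) (F' := intCoeff (bernoulliProd s p) (k + 1))
    (fun i _ => by linarith [h1 i]) (fun i _ => h0 i)
    (fun i _ => by ring)
    (fun i _ => (lc i).nonneg k) (fun i _ => (lc i).nonneg (k + 1))
    (fun i _ => hz i)
    (fun i _ h => (lc i).mul_lt_sq k h)
    (fun i hi => by rw [intCoeff_bernoulliProd_eq hi, add_comm]) hrec
    (sum_one_sub_mul_intCoeff_erase k) (by rw [hsum]; push_cast; ring)
    ((strictlyLogConcave_intCoeff_bernoulliProd h0 h1 s).nonneg _) hk hpos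
  simp only [Finset.sum_sub_distrib, Finset.sum_const, nsmul_eq_mul, mul_one] at this
  linarith

end BernoulliProd

/-! ### Conditioning on parity and the mean -/

/-- The polynomials with `f(1) = 1` and `|f'(-1) + f'(1) f(-1)| ≤ 1 - |f(-1)|`; for a generating
polynomial this bounds the effect on the mean of conditioning on parity. -/
def ParityMeanBound (f : ℝ[X]) : Prop :=
  f.eval 1 = 1 ∧
    |(derivative f).eval (-1) + (derivative f).eval 1 * f.eval (-1)| ≤ 1 - |f.eval (-1)|

/-- With `E f = f'(-1) + f'(1) f(-1)` one has `E (f g) = g(-1) E f + f(-1) E g`, and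
`(1 - s) t + s (1 - t) ≤ 1 - s t` for `s, t` in `[0, 1]`. -/
lemma ParityMeanBound.mul {f g : ℝ[X]} (hf : ParityMeanBound f) (hg : ParityMeanBound g) :
    ParityMeanBound (f * g) := by
  obtain ⟨hf1, hf⟩ := hf
  obtain ⟨hg1, hg⟩ := hg
  refine ⟨by simp [hf1, hg1], ?_⟩
  have hft : |f.eval (-1)| ≤ 1 := by linarith [hf.trans' (abs_nonneg _)]
  have hgt : |g.eval (-1)| ≤ 1 := by linarith [hg.trans' (abs_nonneg _)]
  simp only [derivative_mul, eval_add, eval_mul, hf1, hg1, abs_mul]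
  calc _ = |((derivative f).eval (-1) + (derivative f).eval 1 * f.eval (-1)) * g.eval (-1) +
        f.eval (-1) * ((derivative g).eval (-1) + (derivative g).eval 1 * g.eval (-1))| := by
        congr 1; ring
    _ ≤ (1 - |f.eval (-1)|) * |g.eval (-1)| + |f.eval (-1)| * (1 - |g.eval (-1)|) := by
        refine (abs_add_le _ _).trans ?_
        rw [abs_mul, abs_mul]
        gcongr
    _ ≤ _ := by nlinarith

lemma ParityMeanBound.prod {ι : Type*} (s : Finset ι) (f : ι → ℝ[X])
    (hf : ∀ i ∈ s, ParityMeanBound (f i)) : ParityMeanBound (∏ i ∈ s, f i) :=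
  Finset.prod_induction f ParityMeanBound (fun _ _ => .mul) (by simp [ParityMeanBound]) hf

lemma ParityMeanBound.quadratic {a b c : ℝ} (ha : 0 ≤ a) (hb : 0 ≤ b) (hc : 0 ≤ c)
    (h : a + b + c = 1) : ParityMeanBound (quadratic a b c) := by
  refine ⟨by simp [_root_.quadratic, h], ?_⟩
  simp [_root_.quadratic]
  obtain rfl : a = 1 - b - c := by linarith
  rw [show b + c * (-1 + -1) + (b + c * (1 + 1)) * (1 - b - c + -b + c) =
      2 * b * (1 - b - 2 * c) by ring,
    show 1 - b - c + -b + c = 1 - 2 * b by ring, le_sub_comm]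
  have h1 : |1 - b - 2 * c| ≤ 1 - b := abs_le.2 ⟨by linarith, by linarith⟩
  have h2 : |2 * b * (1 - b - 2 * c)| ≤ 2 * b * (1 - b) := by
    rw [abs_mul, abs_of_nonneg (by positivity : 0 ≤ 2 * b)]
    gcongr
  refine abs_le.2 ⟨?_, ?_⟩ <;> nlinarith

/-- The values and derivatives at `±1` in the decomposition `f(X) = e(X ^ 2) + X * o(X ^ 2)`. -/
lemma evenPart_oddPart_eval (f : ℝ[X]) :
    f.eval 1 = (evenPart f).eval 1 + (oddPart f).eval 1 ∧
    f.eval (-1) = (evenPart f).eval 1 - (oddPart f).eval 1 ∧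
    (derivative f).eval 1 = 2 * (derivative (evenPart f)).eval 1 + (oddPart f).eval 1 +
      2 * (derivative (oddPart f)).eval 1 ∧
    (derivative f).eval (-1) = -(2 * (derivative (evenPart f)).eval 1) + (oddPart f).eval 1 +
      2 * (derivative (oddPart f)).eval 1 := by
  have h : ∀ x, f.eval x = (expand ℝ 2 (evenPart f) + X * expand ℝ 2 (oddPart f)).eval x := by
    intro x; rw [expand_evenPart_add_expand_oddPart]
  have h' : ∀ x, (derivative f).eval x =
      (derivative (expand ℝ 2 (evenPart f) + X * expand ℝ 2 (oddPart f))).eval x := by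
    intro x; rw [expand_evenPart_add_expand_oddPart]
  rw [h, h, h', h']
  simp only [derivative_add, derivative_mul, derivative_X, derivative_expand, eval_add, eval_mul,
    expand_eval, eval_X, eval_one, eval_pow, eval_natCast]
  norm_num
  refine ⟨?_, ?_, ?_⟩ <;> ring

lemma ParityMeanBound.abs_evenPart_sub_le {f : ℝ[X]} (hf : ParityMeanBound f)
    (h : 0 < (evenPart f).eval 1) :
    |(derivative (evenPart f)).eval 1 / (evenPart f).eval 1 - (derivative f).eval 1 / 2|
      ≤ 1 / 2 := by
  obtain ⟨h1, h2⟩ := hf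
  obtain ⟨e1, e2, e3, e4⟩ := evenPart_oddPart_eval f
  rw [h1] at e1
  have h3 := le_abs_self (-f.eval (-1))
  rw [abs_neg] at h3
  have h4 := h2.trans (show _ ≤ 1 + f.eval (-1) by linarith)
  have key : (derivative (evenPart f)).eval 1 / (evenPart f).eval 1 - (derivative f).eval 1 / 2 =
      -((derivative f).eval (-1) + (derivative f).eval 1 * f.eval (-1)) /
        (4 * (evenPart f).eval 1) := by
    field_simp
    rw [e4, e3, e2]
    linear_combination (4 * (derivative (evenPart f)).eval 1
      + 2 * (oddPart f).eval 1 + 4 * (derivative (oddPart f)).eval 1) * e1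
  rw [key, abs_div, abs_neg, abs_of_pos (by positivity : 0 < 4 * (evenPart f).eval 1),
    div_le_iff₀ (by positivity)]
  linarith

lemma ParityMeanBound.abs_oddPart_sub_le {f : ℝ[X]} (hf : ParityMeanBound f)
    (h : 0 < (oddPart f).eval 1) :
    |(derivative (oddPart f)).eval 1 / (oddPart f).eval 1 + 1 / 2 - (derivative f).eval 1 / 2|
      ≤ 1 / 2 := by
  obtain ⟨h1, h2⟩ := hf
  obtain ⟨e1, e2, e3, e4⟩ := evenPart_oddPart_eval f
  rw [h1] at e1
  have h3 := le_abs_self (f.eval (-1))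
  have h4 := h2.trans (show _ ≤ 1 - f.eval (-1) by linarith)
  have key : (derivative (oddPart f)).eval 1 / (oddPart f).eval 1 + 1 / 2
      - (derivative f).eval 1 / 2 =
      ((derivative f).eval (-1) + (derivative f).eval 1 * f.eval (-1)) /
        (4 * (oddPart f).eval 1) := by
    field_simp
    rw [e4, e3, e2]
    linear_combination (4 * (derivative (evenPart f)).eval 1
      + 2 * (oddPart f).eval 1 + 4 * (derivative (oddPart f)).eval 1) * e1
  rw [key, abs_div, abs_of_pos (by positivity : 0 < 4 * (oddPart f).eval 1),
    div_le_iff₀ (by positivity)]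
  linarith

/-! ### Measures with polynomial weights -/

/-- The measure with mass `f.coeff k` at `φ k` for each `k`, for a polynomial `f` with nonnegative
coefficients. -/
noncomputable def atomicMeasure (φ : ℕ → ℝ) (f : ℝ[X]) : Measure ℝ :=
  ∑ k ∈ Finset.range (f.natDegree + 1), ENNReal.ofReal (f.coeff k) • Measure.dirac (φ k)

lemma atomicMeasure_eq_sum (φ : ℕ → ℝ) (f : ℝ[X]) {N : ℕ} (hN : f.natDegree < N) :
    atomicMeasure φ f =
      ∑ k ∈ Finset.range N, ENNReal.ofReal (f.coeff k) • Measure.dirac (φ k) := by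
  refine Finset.sum_subset (Finset.range_mono hN) fun k _ hk => ?_
  rw [coeff_eq_zero_of_natDegree_lt (by simpa using hk), ENNReal.ofReal_zero, zero_smul]

instance (φ : ℕ → ℝ) (f : ℝ[X]) : IsFiniteMeasure (atomicMeasure φ f) := by
  refine ⟨?_⟩
  simp [atomicMeasure, ENNReal.sum_lt_top]

lemma map_atomicMeasure (φ : ℕ → ℝ) (f : ℝ[X]) {g : ℝ → ℝ} (hg : Measurable g) :
    (atomicMeasure φ f).map g = atomicMeasure (g ∘ φ) f := by
  rw [atomicMeasure, Measure.map_finset_sum hg.aemeasurable]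
  simp [atomicMeasure, Measure.map_smul, Measure.map_dirac' hg]

lemma ofReal_smul_atomicMeasure (φ : ℕ → ℝ) (f : ℝ[X]) {c : ℝ} (hc : 0 ≤ c) :
    ENNReal.ofReal c • atomicMeasure φ f = atomicMeasure φ (C c * f) := by
  rw [atomicMeasure_eq_sum φ (C c * f) (Nat.lt_succ_of_le (natDegree_C_mul_le c f)),
    atomicMeasure, Finset.smul_sum]
  simp [smul_smul, ENNReal.ofReal_mul hc]

lemma integral_atomicMeasure {E : Type*} [NormedAddCommGroup E] [NormedSpace ℝ E] [CompleteSpace E]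
    (φ : ℕ → ℝ) {f : ℝ[X]} (hf : ∀ k, 0 ≤ f.coeff k) (F : ℝ → E) :
    ∫ x, F x ∂(atomicMeasure φ f) =
      ∑ k ∈ Finset.range (f.natDegree + 1), f.coeff k • F (φ k) := by
  rw [atomicMeasure, integral_finsetSum_measure]
  · simp [integral_smul_measure, hf]
  · exact fun k _ => (integrable_dirac (by finiteness)).smul_measure (by finiteness)

lemma integral_id_atomicMeasure {f : ℝ[X]} (hf : ∀ k, 0 ≤ f.coeff k) (h s : ℝ) :
    ∫ x, x ∂(atomicMeasure (fun k => k * h + s) f) =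
      h * (derivative f).eval 1 + s * f.eval 1 := by
  rw [integral_atomicMeasure _ hf, derivative_eval, eval_eq_sum_range, Polynomial.sum_over_range,
    Finset.mul_sum, Finset.mul_sum, ← Finset.sum_add_distrib]
  · refine Finset.sum_congr rfl fun k _ => ?_
    simp
    ring
  · simp

lemma charFun_atomicMeasure {f : ℝ[X]} (hf : ∀ k, 0 ≤ f.coeff k) (h t : ℝ) :
    charFun (atomicMeasure (fun k => k * h) f) t = aeval (Complex.exp (t * h * Complex.I)) f := by
  rw [charFun_apply_real, integral_atomicMeasure _ hf, aeval_eq_sum_range]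
  refine Finset.sum_congr rfl fun k _ => ?_
  rw [← Complex.exp_nat_mul]
  congr 2
  push_cast
  ring

lemma atomicMeasure_univ (φ : ℕ → ℝ) {f : ℝ[X]} (hf : ∀ k, 0 ≤ f.coeff k) :
    atomicMeasure φ f Set.univ = ENNReal.ofReal (f.eval 1) := by
  rw [atomicMeasure, Measure.finsetSum_apply, eval_eq_sum_range,
    ENNReal.ofReal_sum_of_nonneg (by simpa using fun k _ => hf k)]
  simp

lemma atomicMeasure_real_singleton {φ : ℕ → ℝ} (hφ : Function.Injective φ) {f : ℝ[X]}
    (hf : ∀ k, 0 ≤ f.coeff k) (k : ℕ) : (atomicMeasure φ f).real {φ k} = f.coeff k := by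
  rw [measureReal_def, atomicMeasure_eq_sum φ f (N := f.natDegree + 1 + k) (by omega),
    Measure.finsetSum_apply]
  simp only [Measure.smul_apply, Measure.dirac_apply' _ (measurableSet_singleton _),
    Set.indicator_apply, Set.mem_singleton_iff, hφ.eq_iff]
  simp only [Pi.one_apply, smul_eq_mul, mul_ite, mul_one, mul_zero, Finset.sum_ite_eq',
    Finset.mem_range]
  split_ifs with h
  · exact ENNReal.toReal_ofReal (hf k)
  · rw [coeff_eq_zero_of_natDegree_lt (by omega), ENNReal.toReal_zero]

lemma atomicMeasure_real_singleton_eq_zero {φ : ℕ → ℝ} {f : ℝ[X]} {x : ℝ} (hx : ∀ k, φ k ≠ x) :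
    (atomicMeasure φ f).real {x} = 0 := by
  simp [measureReal_def, atomicMeasure, Measure.finsetSum_apply, hx,
    Measure.dirac_apply' _ (measurableSet_singleton _)]

/-! ### Restriction to integers and half-integers -/

lemma sum_range_two_mul {M : Type*} [AddCommMonoid M] (g : ℕ → M) (N : ℕ) :
    ∑ k ∈ Finset.range (2 * N), g k = ∑ j ∈ Finset.range N, (g (2 * j) + g (2 * j + 1)) := by
  induction N with
  | zero => simp
  | succ N ih =>
    rw [Nat.mul_succ, Finset.sum_range_succ, Finset.sum_range_succ, Finset.sum_range_succ, ih,
      add_assoc]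

lemma restrict_atomicMeasure (φ : ℕ → ℝ) (f : ℝ[X]) {N : ℕ} (hN : f.natDegree < N) (A : Set ℝ) :
    (atomicMeasure φ f).restrict A = ∑ k ∈ Finset.range N,
      (ENNReal.ofReal (f.coeff k) • (Measure.dirac (φ k)).restrict A) := by
  rw [atomicMeasure_eq_sum φ f hN, ← Measure.restrictₗ_apply, map_sum]
  simp

lemma natDegree_lt_of_coeff_eq {f g : ℝ[X]} {N : ℕ} (hN : f.natDegree < N) {a : ℕ}
    (h : ∀ k, g.coeff k = f.coeff (2 * k + a)) : g.natDegree < N :=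
  (Polynomial.natDegree_le_iff_coeff_eq_zero.2 fun k hk => by
    rw [h, coeff_eq_zero_of_natDegree_lt (by omega)]).trans_lt hN

lemma measurableSet_integerSet : MeasurableSet integerSet := by
  have : integerSet = Set.range fun k : ℤ => (k : ℝ) := by
    ext x; simp [integerSet, eq_comm]
  rw [this]
  exact (Set.countable_range _).measurableSet

lemma measurableSet_halfIntegerSet : MeasurableSet halfIntegerSet := by
  have : halfIntegerSet = Set.range fun k : ℤ => (k : ℝ) + 1 / 2 := by
    ext x; simp [halfIntegerSet, eq_comm]
  rw [this]
  exact (Set.countable_range _).measurableSet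

lemma half_mem_integerSet_iff (k : ℕ) : (k * (1 / 2) : ℝ) ∈ integerSet ↔ Even k := by
  constructor
  · rintro ⟨j, hj⟩
    have : (k : ℤ) = 2 * j := by
      have : (k : ℝ) = 2 * j := by linarith
      exact_mod_cast this
    exact (Int.even_coe_nat k).1 ⟨j, by omega⟩
  · rintro ⟨j, rfl⟩
    exact ⟨j, by push_cast; ring⟩

lemma half_mem_halfIntegerSet_iff (k : ℕ) : (k * (1 / 2) : ℝ) ∈ halfIntegerSet ↔ Odd k := by
  constructor
  · rintro ⟨j, hj⟩
    have : (k : ℤ) = 2 * j + 1 := by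
      have : (k : ℝ) = 2 * j + 1 := by linarith
      exact_mod_cast this
    exact (Int.odd_coe_nat k).1 ⟨j, this⟩
  · rintro ⟨j, rfl⟩
    exact ⟨j, by push_cast; ring⟩

lemma restrict_integerSet_atomicMeasure (f : ℝ[X]) :
    (atomicMeasure (fun k => k * (1 / 2)) f).restrict integerSet =
      atomicMeasure (fun k => k * 1 + 0) (evenPart f) := by
  classical
  rw [restrict_atomicMeasure _ f (N := 2 * (f.natDegree + 1)) (by omega),
    atomicMeasure_eq_sum _ (evenPart f)
      (natDegree_lt_of_coeff_eq (Nat.lt_succ_self _) (a := 0) (coeff_evenPart f)),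
    sum_range_two_mul]
  refine Finset.sum_congr rfl fun k _ => ?_
  simp only [restrict_dirac' measurableSet_integerSet, half_mem_integerSet_iff]
  rw [if_pos (even_two_mul k), if_neg (by simp), smul_zero, add_zero, coeff_evenPart]
  congr 2
  push_cast
  ring

lemma restrict_halfIntegerSet_atomicMeasure (f : ℝ[X]) :
    (atomicMeasure (fun k => k * (1 / 2)) f).restrict halfIntegerSet =
      atomicMeasure (fun k => k * 1 + 1 / 2) (oddPart f) := by
  classical
  rw [restrict_atomicMeasure _ f (N := 2 * (f.natDegree + 1)) (by omega),
    atomicMeasure_eq_sum _ (oddPart f)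
      (natDegree_lt_of_coeff_eq (Nat.lt_succ_self _) (a := 1) (coeff_oddPart f)),
    sum_range_two_mul]
  refine Finset.sum_congr rfl fun k _ => ?_
  simp only [restrict_dirac' measurableSet_halfIntegerSet, half_mem_halfIntegerSet_iff]
  rw [if_neg (by simp), if_pos (odd_two_mul_add_one k), smul_zero, zero_add, coeff_oddPart]
  congr 2
  push_cast
  ring

/-! ### Laws of independent sums -/

lemma coeff_prod_nonneg {ι : Type*} (s : Finset ι) (q : ι → ℝ[X])
    (hq : ∀ i ∈ s, ∀ k, 0 ≤ (q i).coeff k) : ∀ k, 0 ≤ (∏ i ∈ s, q i).coeff k := by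
  refine Finset.prod_induction q (fun f => ∀ k, 0 ≤ f.coeff k) (fun f g hf hg k => ?_)
    (fun k => ?_) hq
  · rw [coeff_mul]
    exact Finset.sum_nonneg fun x _ => mul_nonneg (hf _) (hg _)
  · rw [coeff_one]
    split_ifs <;> norm_num

/-- The generating polynomial of a sum of independent lattice variables is the product of their
generating polynomials. -/
lemma map_sum_eq_atomicMeasure {Ω ι : Type*} [Fintype ι] [MeasurableSpace Ω] {P : Measure Ω}
    [IsProbabilityMeasure P] {Y : ι → Ω → ℝ} (hY : ∀ i, Measurable (Y i)) (hind : iIndepFun Y P)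
    {h : ℝ} {q : ι → ℝ[X]} (hq : ∀ i k, 0 ≤ (q i).coeff k)
    (hlaw : ∀ i, P.map (Y i) = atomicMeasure (fun k => k * h) (q i)) :
    P.map (fun ω => ∑ i, Y i ω) = atomicMeasure (fun k => k * h) (∏ i, q i) := by
  have hfun : (fun ω => ∑ i, Y i ω) = ∑ i, Y i := by
    ext ω; simp
  rw [hfun]
  refine Measure.ext_of_charFun ?_
  rw [hind.charFun_map_sum_eq_prod fun i => (hY i).aemeasurable]
  ext t
  rw [charFun_atomicMeasure (coeff_prod_nonneg _ _ fun i _ => hq i), Finset.prod_apply, map_prod]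
  exact Finset.prod_congr rfl fun i _ => by rw [hlaw, charFun_atomicMeasure (hq i)]

lemma coeff_quadratic_nonneg {a b c : ℝ} (ha : 0 ≤ a) (hb : 0 ≤ b) (hc : 0 ≤ c) (k : ℕ) :
    0 ≤ (quadratic a b c).coeff k := by
  rcases k with _ | _ | _ | k <;> simp [quadratic, coeff_X, coeff_X_pow, coeff_C, ha, hb, hc]

lemma coeff_linear_nonneg {a b : ℝ} (ha : 0 ≤ a) (hb : 0 ≤ b) (k : ℕ) :
    0 ≤ (C a + C b * X).coeff k := by
  rcases k with _ | _ | k <;> simp [coeff_X, coeff_C, ha, hb]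

lemma map_eq_atomicMeasure_quadratic {Ω : Type*} [MeasurableSpace Ω] {P : Measure Ω}
    [IsProbabilityMeasure P] {Y : Ω → ℝ} (hY : Measurable Y)
    (hval : ∀ᵐ ω ∂P, Y ω = 0 ∨ Y ω = 1 / 2 ∨ Y ω = 1) :
    P.map Y = atomicMeasure (fun k => k * (1 / 2))
      (quadratic ((P.map Y).real {0}) ((P.map Y).real {1 / 2}) ((P.map Y).real {1})) := by
  have hae : ∀ᵐ x ∂(P.map Y), x ∈ ({0} ∪ ({1 / 2} ∪ {1}) : Set ℝ) := by
    rw [ae_map_iff hY.aemeasurable (by measurability)]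
    simpa [or_comm, or_assoc, or_left_comm] using hval
  have := Measure.isProbabilityMeasure_map (μ := P) hY.aemeasurable
  rw [atomicMeasure_eq_sum (N := 3)]
  · conv_lhs => rw [← Measure.restrict_eq_self_of_ae_mem hae]
    rw [Measure.restrict_union (by norm_num) (by measurability),
      Measure.restrict_union (by norm_num) (by measurability), Measure.restrict_singleton,
      Measure.restrict_singleton, Measure.restrict_singleton]
    simp [Finset.sum_range_succ, quadratic, coeff_X, coeff_C, coeff_X_pow, add_assoc]
  · rw [quadratic]
    refine Nat.lt_succ_of_le ?_
    compute_degree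

lemma real_singleton_sum_eq_one {Ω : Type*} [MeasurableSpace Ω] {P : Measure Ω}
    [IsProbabilityMeasure P] {Y : Ω → ℝ} (hY : Measurable Y)
    (hval : ∀ᵐ ω ∂P, Y ω = 0 ∨ Y ω = 1 / 2 ∨ Y ω = 1) :
    (P.map Y).real {0} + (P.map Y).real {1 / 2} + (P.map Y).real {1} = 1 := by
  have := Measure.isProbabilityMeasure_map (μ := P) hY.aemeasurable
  have h := congrArg (fun μ => μ Set.univ) (map_eq_atomicMeasure_quadratic hY hval)
  simp only [measure_univ] at h
  rw [atomicMeasure_univ _ (coeff_quadratic_nonneg (by positivity) (by positivity)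
    (by positivity))] at h
  have := (ENNReal.ofReal_eq_one.1 h.symm)
  simpa [quadratic] using this

lemma bernoulliMeasure_eq_atomicMeasure (p : unitInterval) :
    bernoulliMeasure (1 : ℝ) 0 p =
      atomicMeasure (fun k => k * 1) (C (1 - (p : ℝ)) + C (p : ℝ) * X) := by
  rw [atomicMeasure_eq_sum (N := 2), bernoulliMeasure_def]
  · have h : ∀ q : unitInterval, ENNReal.ofReal (q : ℝ) = (unitInterval.toNNReal q : ENNReal) :=
      fun q => ENNReal.ofReal_eq_coe_nnreal q.2.1
    have h' := h (unitInterval.symm p)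
    rw [unitInterval.coe_symm_eq] at h'
    simp only [Finset.sum_range_succ, Finset.range_zero, Finset.sum_empty, zero_add, coeff_add,
      coeff_C_mul, coeff_C_zero, coeff_X_zero, coeff_X_one, mul_zero, mul_one, add_zero,
      coeff_C_of_ne_zero one_ne_zero, Nat.cast_zero, Nat.cast_one]
    rw [h, h', add_comm]
    rfl
  · exact Nat.lt_succ_of_le (by compute_degree)

lemma poissonBinomial_eq_atomicMeasure {m : ℕ} (p : Fin m → unitInterval) :
    poissonBinomial p =
      atomicMeasure (fun k => k * 1) (bernoulliProd Finset.univ fun i => (p i : ℝ)) := by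
  refine map_sum_eq_atomicMeasure (Y := fun i (x : Fin m → ℝ) => x i)
    (fun i => measurable_pi_apply i) (iIndepFun_pi (X := fun _ x => x) fun i => aemeasurable_id)
    (fun i => coeff_linear_nonneg (by linarith [(p i).2.2]) (p i).2.1) fun i => ?_
  rw [← bernoulliMeasure_eq_atomicMeasure]
  exact (measurePreserving_eval _ i).map_eq

/-! ### Conditional laws -/

lemma condLaw_eq {Ω : Type*} [MeasurableSpace Ω] (P : Measure Ω) {Y : Ω → ℝ} (hY : Measurable Y)
    {A : Set ℝ} (hA : MeasurableSet A) :
    condLaw P Y A = (P.map Y A)⁻¹ • (P.map Y).restrict A := by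
  rw [condLaw, ProbabilityTheory.cond, Measure.map_smul, Measure.map_apply hY hA,
    Measure.restrict_map hY hA]

lemma condMean_eq_integral_condLaw {Ω : Type*} [MeasurableSpace Ω] (P : Measure Ω) {Y : Ω → ℝ}
    (hY : Measurable Y) (A : Set ℝ) : condMean P Y A = ∫ x, x ∂(condLaw P Y A) := by
  rw [condLaw, integral_map hY.aemeasurable (by fun_prop)]
  rfl

lemma condLaw_eq_atomicMeasure {Ω : Type*} [MeasurableSpace Ω] {P : Measure Ω} {Y : Ω → ℝ}
    (hY : Measurable Y) {A : Set ℝ} (hA : MeasurableSet A) (hpos : 0 < P (Y ⁻¹' A)) {φ : ℕ → ℝ}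
    {g : ℝ[X]} (hg : ∀ k, 0 ≤ g.coeff k) (h : (P.map Y).restrict A = atomicMeasure φ g) :
    0 < g.eval 1 ∧ condLaw P Y A = atomicMeasure φ (C (g.eval 1)⁻¹ * g) := by
  have hA' : P.map Y A = ENNReal.ofReal (g.eval 1) := by
    rw [← atomicMeasure_univ φ hg, ← h, Measure.restrict_apply_univ]
  have hg1 : 0 < g.eval 1 := by
    rwa [← Measure.map_apply hY hA, hA', ENNReal.ofReal_pos] at hpos
  refine ⟨hg1, ?_⟩
  rw [condLaw_eq P hY hA, hA', h, ← ENNReal.ofReal_inv_of_pos hg1,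
    ofReal_smul_atomicMeasure _ _ (by positivity)]

/-! ### Modes of shifted Poisson binomial distributions -/

section ShiftedPoissonBinomial

variable {m : ℕ} {p : Fin m → unitInterval} {s : ℝ}

lemma atomicMeasure_real_int {g : ℝ[X]} (hg : ∀ k, 0 ≤ g.coeff k) (s : ℝ) (k : ℤ) :
    (atomicMeasure (fun k => k * 1 + s) g).real {(k : ℝ) + s} = intCoeff g k := by
  rcases lt_or_ge k 0 with hk | hk
  · rw [intCoeff_of_neg _ hk]
    refine atomicMeasure_real_singleton_eq_zero fun j hj => ?_
    have : (j : ℝ) = k := by linarith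
    have : (j : ℤ) = k := by exact_mod_cast this
    omega
  · lift k to ℕ using hk
    have hinj : Function.Injective fun k : ℕ => (k * 1 + s : ℝ) := fun a b hab => by
      simpa using hab
    simpa using atomicMeasure_real_singleton hinj hg k

lemma exists_max_intCoeff {g : ℝ[X]} (hg : ∀ k, 0 ≤ g.coeff k) (h1 : 0 < g.eval 1) :
    ∃ k, (∀ j, intCoeff g j ≤ intCoeff g k) ∧ 0 < intCoeff g k := by
  rw [eval_eq_sum_range] at h1
  obtain ⟨i, hi, hne⟩ := Finset.exists_ne_zero_of_sum_ne_zero h1.ne'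
  rw [one_pow, mul_one] at hne
  have hpos : 0 < g.coeff i := (hg i).lt_of_ne' hne
  obtain ⟨k, hk, hmax⟩ := Finset.exists_max_image (Finset.range (g.natDegree + 1)) g.coeff ⟨i, hi⟩
  have hkpos := hpos.trans_le (hmax i hi)
  refine ⟨k, fun j => ?_, by simpa using hkpos⟩
  rw [intCoeff_natCast]
  rcases lt_or_ge j 0 with hj | hj
  · rw [intCoeff_of_neg _ hj]; exact hkpos.le
  · lift j to ℕ using hj
    rw [intCoeff_natCast]
    by_cases hjr : j ∈ Finset.range (g.natDegree + 1)
    · exact hmax j hjr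
    · rw [coeff_eq_zero_of_natDegree_lt (by simpa using hjr)]
      exact hkpos.le

lemma isMode_atomicMeasure_iff {g : ℝ[X]} (hg : ∀ k, 0 ≤ g.coeff k) (h1 : 0 < g.eval 1) (s x : ℝ) :
    IsMode (atomicMeasure (fun k => k * 1 + s) g) x ↔
      ∃ k : ℤ, x = k + s ∧ ∀ j, intCoeff g j ≤ intCoeff g k := by
  have hreal : IsMode (atomicMeasure (fun k => k * 1 + s) g) x ↔
      ∀ y, (atomicMeasure (fun k => k * 1 + s) g).real {y} ≤
        (atomicMeasure (fun k => k * 1 + s) g).real {x} :=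
    forall_congr' fun y => (ENNReal.toReal_le_toReal (by finiteness) (by finiteness)).symm
  have hoff : ∀ y : ℝ, (∀ k : ℤ, y ≠ k + s) →
      (atomicMeasure (fun k => k * 1 + s) g).real {y} = 0 := fun y hy =>
    atomicMeasure_real_singleton_eq_zero fun j hj => hy j (by simp [← hj])
  rw [hreal]
  constructor
  · intro h
    obtain ⟨i, -, hi⟩ := exists_max_intCoeff hg h1
    have hx : ∃ k : ℤ, x = k + s := by
      by_contra! hx
      have := h (i + s)
      rw [hoff x hx, atomicMeasure_real_int hg] at this
      linarith
    obtain ⟨k, rfl⟩ := hx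
    refine ⟨k, rfl, fun j => ?_⟩
    simpa only [atomicMeasure_real_int hg] using h (j + s)
  · rintro ⟨k, rfl, hk⟩ y
    by_cases hy : ∃ j : ℤ, y = j + s
    · obtain ⟨j, rfl⟩ := hy
      simpa only [atomicMeasure_real_int hg] using hk j
    · push Not at hy
      rw [hoff y hy]
      exact measureReal_nonneg

lemma coeff_bernoulliProd_nonneg (p : Fin m → unitInterval) (k : ℕ) :
    0 ≤ (bernoulliProd Finset.univ fun i => (p i : ℝ)).coeff k :=
  coeff_prod_nonneg _ _ (fun i _ => coeff_linear_nonneg (by linarith [(p i).2.2]) (p i).2.1) k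

lemma isLogConcave_shifted_poissonBinomial {ν : Measure ℝ}
    (hν : ν = atomicMeasure (fun k => k * 1 + s) (bernoulliProd Finset.univ fun i => (p i : ℝ))) :
    IsLogConcave fun k : ℤ => ν.real {(k : ℝ) + s} := by
  simp only [hν, atomicMeasure_real_int (coeff_bernoulliProd_nonneg p)]
  exact (strictlyLogConcave_intCoeff_bernoulliProd (fun i => (p i).2.1) (fun i => (p i).2.2)
    _).isLogConcave

lemma hasOneOrTwoAdjacentModes_shifted_poissonBinomial {ν : Measure ℝ}
    (hν : ν = atomicMeasure (fun k => k * 1 + s) (bernoulliProd Finset.univ fun i => (p i : ℝ))) :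
    HasOneOrTwoAdjacentModes ν := by
  have h1 : 0 < (bernoulliProd Finset.univ fun i => (p i : ℝ)).eval 1 := by
    rw [eval_one_bernoulliProd]; exact one_pos
  obtain ⟨k, hk, hpos⟩ := exists_max_intCoeff (coeff_bernoulliProd_nonneg p) h1
  obtain ⟨l, hl⟩ := (strictlyLogConcave_intCoeff_bernoulliProd (fun i => (p i).2.1)
    (fun i => (p i).2.2) Finset.univ).exists_maximizers_eq hk hpos
  have himage : {x | IsMode ν x} = (fun k : ℤ => (k : ℝ) + s) '' {j | ∀ i,
      intCoeff (bernoulliProd Finset.univ fun i => (p i : ℝ)) i ≤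
        intCoeff (bernoulliProd Finset.univ fun i => (p i : ℝ)) j} := by
    ext x
    rw [Set.mem_ofPred_eq, hν, isMode_atomicMeasure_iff (coeff_bernoulliProd_nonneg p) h1]
    simp only [Set.mem_image, Set.mem_ofPred_eq]
    exact ⟨fun ⟨k, h, h'⟩ => ⟨k, h', h.symm⟩, fun ⟨k, h, h'⟩ => ⟨k, h'.symm, h⟩⟩
  refine ⟨l + s, ?_⟩
  rw [himage]
  rcases hl with hl | hl
  · left
    rw [hl, Set.image_singleton]
  · right
    rw [hl, Set.image_pair]
    congr 2
    push_cast
    ring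

/-- Darroch's theorem: a mode of a shifted Poisson binomial distribution differs from the mean by
less than one. -/
lemma abs_mode_sub_mean_lt_one {ν : Measure ℝ}
    (hν : ν = atomicMeasure (fun k => k * 1 + s) (bernoulliProd Finset.univ fun i => (p i : ℝ)))
    {x : ℝ} (hx : IsMode ν x) : |x - ∫ y, y ∂ν| < 1 := by
  have h1 : 0 < (bernoulliProd Finset.univ fun i => (p i : ℝ)).eval 1 := by
    rw [eval_one_bernoulliProd]; exact one_pos
  rw [hν, isMode_atomicMeasure_iff (coeff_bernoulliProd_nonneg p) h1] at hx
  obtain ⟨k, rfl, hk⟩ := hx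
  obtain ⟨i, -, hi⟩ := exists_max_intCoeff (coeff_bernoulliProd_nonneg p) h1
  have hpos := hi.trans_le (hk i)
  rw [hν, integral_id_atomicMeasure (coeff_bernoulliProd_nonneg p),
    eval_one_derivative_bernoulliProd, eval_one_bernoulliProd]
  have l := sub_one_lt_sum_of_intCoeff_le (fun i => (p i).2.1) (fun i => (p i).2.2)
    (hk (k - 1)) hpos
  have u := sum_lt_add_one_of_intCoeff_le (fun i => (p i).2.1) (fun i => (p i).2.2)
    (hk (k + 1)) hpos
  rw [abs_lt]
  constructor <;> linarith

end ShiftedPoissonBinomial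

/-! ### Normalized even and odd parts -/

lemma exists_C_inv_mul_eq_bernoulliProd {g : ℝ[X]} (hg : ∀ k, 0 ≤ g.coeff k) (h1 : 0 < g.eval 1)
    (hroots : ∀ w : ℂ, aeval w g = 0 → w.im = 0) : ∃ (m : ℕ) (p : Fin m → unitInterval),
      C (g.eval 1)⁻¹ * g = bernoulliProd Finset.univ fun i => (p i : ℝ) := by
  refine Splits.exists_eq_bernoulliProd ((splits_of_real_roots hroots).C_mul _) (fun k => ?_) ?_
  · rw [coeff_C_mul]
    exact mul_nonneg (inv_nonneg.2 h1.le) (hg k)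
  · simp [h1.ne']

lemma integral_normalized {g : ℝ[X]} (hg : ∀ k, 0 ≤ g.coeff k) (h1 : 0 < g.eval 1) (s : ℝ) :
    ∫ x, x ∂(atomicMeasure (fun k => k * 1 + s) (C (g.eval 1)⁻¹ * g)) =
      (derivative g).eval 1 / g.eval 1 + s := by
  rw [integral_id_atomicMeasure]
  · simp [derivative_mul, h1.ne']
    ring
  · intro k
    rw [coeff_C_mul]
    exact mul_nonneg (inv_nonneg.2 h1.le) (hg k)

/-! ### Sums of variables with values in the half-integers -/

theorem theorem1p1 {Ω : Type*} [MeasurableSpace Ω] (P : Measure Ω) [IsProbabilityMeasure P]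
    (n : ℕ) (Xi : Fin n → Ω → ℝ)
    (hmeas : ∀ i, Measurable (Xi i))
    (hval : ∀ i, ∀ᵐ ω ∂P, Xi i ω = 0 ∨ Xi i ω = 1 / 2 ∨ Xi i ω = 1)
    (hindep : iIndepFun Xi P)
    (X : Ω → ℝ) (hX : X = fun ω => ∑ i, Xi i ω)
    (heven : 0 < P (X ⁻¹' integerSet))
    (hodd : 0 < P (X ⁻¹' halfIntegerSet)) :
    -- both conditional distributions are Poisson binomial (the second one shifted by `1/2`)
    IsPoissonBinomial (condLaw P X integerSet) ∧
    IsPoissonBinomial ((condLaw P X halfIntegerSet).map fun x => x - 1 / 2) ∧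
    -- they are log-concave on their lattices
    IsLogConcave (fun k : ℤ => (condLaw P X integerSet).real {(k : ℝ)}) ∧
    IsLogConcave (fun k : ℤ => (condLaw P X halfIntegerSet).real {(k : ℝ) + 1 / 2}) ∧
    -- they have one mode or two adjacent modes
    HasOneOrTwoAdjacentModes (condLaw P X integerSet) ∧
    HasOneOrTwoAdjacentModes (condLaw P X halfIntegerSet) ∧
    -- the conditional means are close to the mean
    |condMean P X integerSet - ∫ ω, X ω ∂P| ≤ 1 / 2 ∧
    |condMean P X halfIntegerSet - ∫ ω, X ω ∂P| ≤ 1 / 2 ∧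
    |condMean P X integerSet - condMean P X halfIntegerSet| ≤ 1 ∧
    -- all conditional modes are close to the conditional means, to the mean and to each other
    (∀ mEven, IsMode (condLaw P X integerSet) mEven →
      |mEven - condMean P X integerSet| < 1 ∧ |mEven - ∫ ω, X ω ∂P| < 3 / 2) ∧
    (∀ mOdd, IsMode (condLaw P X halfIntegerSet) mOdd →
      |mOdd - condMean P X halfIntegerSet| < 1 ∧ |mOdd - ∫ ω, X ω ∂P| < 3 / 2) ∧
    (∀ mEven mOdd, IsMode (condLaw P X integerSet) mEven →
      IsMode (condLaw P X halfIntegerSet) mOdd → |mEven - mOdd| ≤ 5 / 2) := by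
  have hXm : Measurable X := by
    rw [hX]; exact Finset.measurable_sum _ fun i _ => hmeas i
  -- `f` is the generating polynomial of `2 * X`.
  obtain ⟨f, hf0, hlaw, hdom, hbound⟩ : ∃ f : ℝ[X], (∀ k, 0 ≤ f.coeff k) ∧
      P.map X = atomicMeasure (fun k => k * (1 / 2)) f ∧ RightHalfPlaneDominant f ∧
      ParityMeanBound f := by
    have hsum := fun i => real_singleton_sum_eq_one (hmeas i) (hval i)
    have hnn := fun i => coeff_quadratic_nonneg (a := (P.map (Xi i)).real {0})
      (b := (P.map (Xi i)).real {1 / 2}) (c := (P.map (Xi i)).real {1})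
      (by positivity) (by positivity) (by positivity)
    refine ⟨_, coeff_prod_nonneg Finset.univ _ fun i _ => hnn i, ?_,
      RightHalfPlaneDominant.prod _ _ fun i _ => ?_, ParityMeanBound.prod _ _ fun i _ => ?_⟩
    · rw [hX]
      exact map_sum_eq_atomicMeasure hmeas hindep hnn fun i =>
        map_eq_atomicMeasure_quadratic (hmeas i) (hval i)
    · exact .quadratic (by positivity) (by positivity) (by positivity) (by rw [hsum]; exact one_pos)
    · exact .quadratic (by positivity) (by positivity) (by positivity) (hsum i)
  have hmean : ∫ ω, X ω ∂P = (derivative f).eval 1 / 2 := by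
    have h := integral_id_atomicMeasure hf0 (1 / 2) 0
    simp only [add_zero, zero_mul] at h
    rw [← hlaw, integral_map hXm.aemeasurable (by fun_prop)] at h
    rw [h]; ring
  have he0 : ∀ k, 0 ≤ (evenPart f).coeff k := fun k => by rw [coeff_evenPart]; exact hf0 _
  have ho0 : ∀ k, 0 ≤ (oddPart f).coeff k := fun k => by rw [coeff_oddPart]; exact hf0 _
  obtain ⟨he1, helaw⟩ := condLaw_eq_atomicMeasure hXm measurableSet_integerSet heven he0
    (by rw [hlaw]; exact restrict_integerSet_atomicMeasure f)
  obtain ⟨ho1, holaw⟩ := condLaw_eq_atomicMeasure hXm measurableSet_halfIntegerSet hodd ho0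
    (by rw [hlaw]; exact restrict_halfIntegerSet_atomicMeasure f)
  have hemean : condMean P X integerSet =
      (derivative (evenPart f)).eval 1 / (evenPart f).eval 1 := by
    rw [condMean_eq_integral_condLaw P hXm, helaw, integral_normalized he0 he1, add_zero]
  have homean : condMean P X halfIntegerSet =
      (derivative (oddPart f)).eval 1 / (oddPart f).eval 1 + 1 / 2 := by
    rw [condMean_eq_integral_condLaw P hXm, holaw, integral_normalized ho0 ho1]
  have hemu : |condMean P X integerSet - ∫ ω, X ω ∂P| ≤ 1 / 2 := by
    rw [hemean, hmean]; exact hbound.abs_evenPart_sub_le he1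
  have homu : |condMean P X halfIntegerSet - ∫ ω, X ω ∂P| ≤ 1 / 2 := by
    rw [homean, hmean]; exact hbound.abs_oddPart_sub_le ho1
  have hemode : ∀ x, IsMode (condLaw P X integerSet) x → ∃ k : ℤ, x = k := by
    intro x hx
    have hg : ∀ k, 0 ≤ (C ((evenPart f).eval 1)⁻¹ * evenPart f).coeff k := fun k => by
      rw [coeff_C_mul]; exact mul_nonneg (inv_nonneg.2 he1.le) (he0 k)
    rw [helaw, isMode_atomicMeasure_iff hg (by simp [he1.ne'])] at hx
    obtain ⟨k, hk, -⟩ := hx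
    exact ⟨k, by rw [hk, add_zero]⟩
  have homode : ∀ x, IsMode (condLaw P X halfIntegerSet) x → ∃ k : ℤ, x = k + 1 / 2 := by
    intro x hx
    have hg : ∀ k, 0 ≤ (C ((oddPart f).eval 1)⁻¹ * oddPart f).coeff k := fun k => by
      rw [coeff_C_mul]; exact mul_nonneg (inv_nonneg.2 ho1.le) (ho0 k)
    rw [holaw, isMode_atomicMeasure_iff hg (by simp [ho1.ne'])] at hx
    obtain ⟨k, hk, -⟩ := hx
    exact ⟨k, hk⟩
  obtain ⟨me, pe, hpe⟩ := exists_C_inv_mul_eq_bernoulliProd he0 he1 fun w =>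
    hdom.real_root_evenPart he1.ne'
  obtain ⟨mo, po, hpo⟩ := exists_C_inv_mul_eq_bernoulliProd ho0 ho1 fun w =>
    hdom.real_root_oddPart ho1.ne'
  rw [hpe] at helaw
  rw [hpo] at holaw
  have hedarroch : ∀ x, IsMode (condLaw P X integerSet) x →
      |x - condMean P X integerSet| < 1 := fun x hx => by
    rw [condMean_eq_integral_condLaw P hXm]; exact abs_mode_sub_mean_lt_one helaw hx
  have hodarroch : ∀ x, IsMode (condLaw P X halfIntegerSet) x →
      |x - condMean P X halfIntegerSet| < 1 := fun x hx => by
    rw [condMean_eq_integral_condLaw P hXm]; exact abs_mode_sub_mean_lt_one holaw hx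
  have he3 : ∀ x, IsMode (condLaw P X integerSet) x → |x - ∫ ω, X ω ∂P| < 3 / 2 := fun x hx => by
    linarith [abs_sub_le x (condMean P X integerSet) (∫ ω, X ω ∂P), hedarroch x hx]
  have ho3 : ∀ x, IsMode (condLaw P X halfIntegerSet) x → |x - ∫ ω, X ω ∂P| < 3 / 2 :=
    fun x hx => by
      linarith [abs_sub_le x (condMean P X halfIntegerSet) (∫ ω, X ω ∂P), hodarroch x hx]
  refine ⟨⟨me, pe, ?_⟩, ⟨mo, po, ?_⟩, ?_, isLogConcave_shifted_poissonBinomial holaw,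
    hasOneOrTwoAdjacentModes_shifted_poissonBinomial helaw,
    hasOneOrTwoAdjacentModes_shifted_poissonBinomial holaw, hemu, homu, ?_,
    fun x hx => ⟨hedarroch x hx, he3 x hx⟩, fun x hx => ⟨hodarroch x hx, ho3 x hx⟩,
    fun x y hx hy => ?_⟩
  · rw [helaw, poissonBinomial_eq_atomicMeasure]
    simp
  · rw [holaw, map_atomicMeasure _ _ (by fun_prop), poissonBinomial_eq_atomicMeasure]
    congr 1
    ext k
    simp
  · simpa using isLogConcave_shifted_poissonBinomial helaw
  · have := abs_sub_le (condMean P X integerSet) (∫ ω, X ω ∂P) (condMean P X halfIntegerSet)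
    rw [abs_sub_comm (∫ ω, X ω ∂P)] at this
    linarith
  · have h := abs_sub_le x (∫ ω, X ω ∂P) y
    rw [abs_sub_comm (∫ ω, X ω ∂P)] at h
    have h3 : |x - y| < 3 := by linarith [he3 x hx, ho3 y hy]
    obtain ⟨i, rfl⟩ := hemode x hx
    obtain ⟨j, rfl⟩ := homode y hy
    -- The difference of the modes is a half-integer, so a distance below `3` is at most `5 / 2`.
    rw [abs_lt] at h3
    have h4 : (i : ℝ) - j < 4 := by linarith
    have h5 : -3 < (i : ℝ) - j := by linarith
    have h4' : i - j < 4 := by exact_mod_cast h4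
    have h5' : -3 < i - j := by exact_mod_cast h5
    have h6 : (i : ℝ) - j ≤ 3 := by exact_mod_cast (by omega : i - j ≤ 3)
    have h7 : -2 ≤ (i : ℝ) - j := by exact_mod_cast (by omega : -2 ≤ i - j)
    rw [abs_le]
    constructor <;> linarith
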